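/- Let $1\le m\le n$ be integers and $p\in[0,1]$. A street has $n$ spots $1,\dots,n$, and $m$ cars enter one after another; car $i$ has a preferred spot $a_i\in[n]=\{1,\dots,n\}$. A car that finds its preferred spot free parks there. Otherwise it tosses a coin (independent of everything else) showing heads with probability $p$: on heads it moves forward and parks in the first free spot after its preferred one, on tails it moves backward and parks in the nearest free spot before its preferred one; if there is no such spot, the car fails to park. Let the preference list $\alpha=(a_1,\dots,a_m)$ be uniformly distributed on $[n]^m$, let $Q_{m,n,p}$ be the conditional law of $a_m$ (the preference of the last car) given that all $m$ cars park, and let $\mathrm{Uni}_n$ be the uniform law on $[n]$. For probability laws $P,Q$ on $[n]$ put $\|P-Q\|_{\mathrm{TV}}=\frac12\sum_{j=1}^n|P(j)-Q(j)|$. Then $$\|Q_{m,n,p}-\mathrm{Uni}_n\|_{\mathrm{TV}}\le\frac{m-1}{(n+1)(n-m+1)}$$ and $$\|Q_{m,n,p}-\mathrm{Uni}_n\|_{\mathrm{TV}}\ge\frac{|2p-1|}{4n}\left|1-\frac{e^{n+1}(m-1)!\,\mathbb P(Z\le m-1)}{(n+1)^{m-1}}\right|,$$ where $Z$ has the Poisson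 distribution with parameter $n+1$. Additionally, for $p=1/2$, $$\|Q_{m,n,1/2}-\mathrm{Uni}_n\|_{\mathrm{TV}}\ge\frac12\left|\frac{n^{m-2}}{2(n+1)^{m-1}}-\frac1{2(n+1)}\left[1+\frac{n-2m+2}{n(n-m+1)}\right]\right|.$$ -/

import Mathlib

open MeasureTheory ProbabilityTheory
open scoped NNReal Nat

namespace ProbParking

/-! The `n` spots of the street are the elements of `Fin n` (spot `j : Fin n` is the spot numbered
`j + 1` in `[n] = {1, …, n}`), and the `m` cars are the elements of `Fin m`, in order of arrival. -/

/-- The unoccupied spots strictly ahead of spot `a`, when the spots in `occ` are occupied. -/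
def freeAhead {n : ℕ} (occ : Finset (Fin n)) (a : Fin n) : Finset (Fin n) :=
  Finset.univ.filter fun b => a < b ∧ b ∉ occ

/-- The unoccupied spots strictly behind spot `a`, when the spots in `occ` are occupied. -/
def freeBehind {n : ℕ} (occ : Finset (Fin n)) (a : Fin n) : Finset (Fin n) :=
  Finset.univ.filter fun b => b < a ∧ b ∉ occ

/-- The spot in which a car with preference `a` parks, when the spots in `occ` are occupied
(`none` if the car cannot park). If `a` is free, the car parks there, whatever its coin shows.
If `a` is occupied and the coin shows heads (`true`), the car moves forward to the first free spot
after `a`; if the coin shows tails (`false`), it moves backward to the first free spot that it meets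
before `a`. -/
def parkSpot {n : ℕ} (occ : Finset (Fin n)) (a : Fin n) (coin : Bool) : Option (Fin n) :=
  if a ∉ occ then some a
  else if coin = true then
    if h : (freeAhead occ a).Nonempty then some ((freeAhead occ a).min' h) else none
  else
    if h : (freeBehind occ a).Nonempty then some ((freeBehind occ a).max' h) else none

/-- The set of occupied spots after the first `k` cars have arrived, for the preference list `α`
and the coins `c` (the coin `c i` is the one that car `i` uses if its preferred spot is occupied).
A car that cannot park leaves the street without occupying a spot. -/
def occupied {m n : ℕ} (α : Fin m → Fin n) (c : Fin m → Bool) : ℕ → Finset (Fin n)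
  | 0 => ∅
  | k + 1 =>
    if h : k < m then
      occupied α c k ∪ (parkSpot (occupied α c k) (α ⟨k, h⟩) (c ⟨k, h⟩)).toFinset
    else occupied α c k

/-- All `m` cars are able to park. -/
def AllPark {m n : ℕ} (α : Fin m → Fin n) (c : Fin m → Bool) : Prop :=
  ∀ i : Fin m, parkSpot (occupied α c i) (α i) (c i) ≠ none

/-- The joint law of the preference list and of the coins: the preference list is uniform on
`[n]^m` and, independently of it, the `m` coins are independent and show heads with
probability `p`. -/
noncomputable def parkingMeasure (m n : ℕ) (p : unitInterval) :
    Measure ((Fin m → Fin n) × (Fin m → Bool)) :=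
  (uniformOn Set.univ).prod (Measure.pi fun _ => bernoulliMeasure true false p)

/-- The event that all cars park. -/
def allParkEvent (m n : ℕ) : Set ((Fin m → Fin n) × (Fin m → Bool)) :=
  {ω | AllPark ω.1 ω.2}

/-- The conditional law of the preference of the last car, given that all cars park, under the
protocol with parameter `p`. -/
noncomputable def lastCarLaw (m n : ℕ) (hm : 1 ≤ m) (p : unitInterval) : Measure (Fin n) :=
  (cond (parkingMeasure m n p) (allParkEvent m n)).map
    fun ω => ω.1 ⟨m - 1, Nat.sub_lt hm Nat.one_pos⟩

/-- The uniform law on the `n` spots. -/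
noncomputable def uniformLaw (n : ℕ) : Measure (Fin n) := uniformOn Set.univ

/-- The total variation distance of two probability laws on `[n]`. -/
noncomputable def tvDist {n : ℕ} (P Q : Measure (Fin n)) : ℝ :=
  1 / 2 * ∑ j : Fin n, |P.real {j} - Q.real {j}|

end ProbParking

namespace ProbParking

/-! Write `m = M + 1`. The last car with preference `j` fails exactly when it tosses heads and the
spots from `j` to the end are all taken, or tosses tails and the spots up to `j` are all taken. So
its law is an affine function of the failure weights `F j = p * tailWeight + (1 - p) * headWeight`
(`lastCarLaw_real`), and the distance to uniform measures how far `F` is from constant.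

The weight of an outcome obeys a recursion on the last spot filled (`outcomeWeight`), and a free
spot splits it into two independent streets (`outcomeWeight_union`). On a fully occupied interval,
reflection gives the left and right runs the same mean, so `p` drops out (`outcomeWeight_interval`).
Splitting at the first free spot and using Abel's identity, the total weight is the classical number
`lineCount n M` of parking functions, for every `p` (`sum_outcomeWeight`).

Upper bound: `F` is nonnegative with known sum, so the triangle inequality suffices (`sum_abs_le`).
General lower bound: test against `2j + 1 - n`, which kills constants and is at most `n` in absolute
value (`le_sum_abs`); the moment is a difference of two Abel sums, one of them a truncated
exponential series and hence a Poisson probability (`sum_centered_fault`). Bound for `p = 1/2`: keep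
only the first spot, where `F` is explicit. -/

/-! ### Abel-type identities -/

/-- Two Appell sequences with the same values at one point are equal. -/
theorem appell_unique {f g : ℕ → ℝ → ℝ} (z₀ : ℝ) (h0 : ∀ z, f 0 z = g 0 z)
    (hf : ∀ M z, HasDerivAt (f (M + 1)) ((M + 1) * f M z) z)
    (hg : ∀ M z, HasDerivAt (g (M + 1)) ((M + 1) * g M z) z)
    (hv : ∀ M, f M z₀ = g M z₀) (M : ℕ) (z : ℝ) : f M z = g M z := by
  induction M generalizing z with
  | zero => exact h0 z
  | succ M ih =>
    have hd : ∀ x, HasDerivAt (fun y => f (M + 1) y - g (M + 1) y) 0 x := fun x => by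
      have := (hf M x).sub (hg M x)
      rwa [ih x, sub_self] at this
    have := is_const_of_deriv_eq_zero (fun x => (hd x).differentiableAt)
      (fun x => (hd x).deriv) z z₀
    simp only [hv, sub_self] at this
    linarith

/-- The Appell sequence with Abel-type coefficients. -/
noncomputable def abelSum (c : ℕ → ℝ) (M : ℕ) (z : ℝ) : ℝ :=
  ∑ k ∈ Finset.range (M + 1), (M.choose k : ℝ) * c k * (z - k) ^ (M - k)

theorem hasDerivAt_abelSum (c : ℕ → ℝ) (M : ℕ) (z : ℝ) :
    HasDerivAt (abelSum c (M + 1)) ((M + 1) * abelSum c M z) z := by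
  unfold abelSum
  have key : ((M : ℝ) + 1) * ∑ k ∈ Finset.range (M + 1), (M.choose k : ℝ) * c k * (z - k) ^ (M - k)
      = ∑ k ∈ Finset.range (M + 1 + 1), ((M + 1).choose k : ℝ) * c k *
        (((M + 1 - k : ℕ) : ℝ) * (z - k) ^ (M + 1 - k - 1)) := by
    rw [Finset.sum_range_succ _ (M + 1), Finset.mul_sum]
    simp only [Nat.sub_self, Nat.cast_zero, zero_mul, mul_zero, add_zero]
    refine Finset.sum_congr rfl fun k hk => ?_
    have h := Nat.choose_mul_succ_eq M k
    have h' : (M.choose k : ℝ) * (M + 1) = (M + 1).choose k * ((M + 1 - k : ℕ) : ℝ) := by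
      exact_mod_cast h
    have e : M + 1 - k - 1 = M - k := by omega
    rw [e]
    linear_combination (c k * (z - k) ^ (M - k)) * h'
  rw [key]
  refine HasDerivAt.fun_sum fun k _ => HasDerivAt.const_mul _ ?_
  simpa using ((hasDerivAt_id z).sub_const (k : ℝ)).fun_pow (M + 1 - k)

/-- Evaluating an Abel sum at `-1` turns `(z - k) ^ (M - k)` into a signed power of `k + 1`. The
value is then an `M`-th finite difference of a monomial, which is `0` below degree `M` and `M !` in
degree `M`. -/
theorem sum_choose_neg_pow_mul (M j : ℕ) :
    ∑ k ∈ Finset.range (M + 1), (M.choose k : ℝ) * (-1) ^ (M - k) * ((k : ℝ) + 1) ^ j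
      = (fwdDiff (1 : ℝ))^[M] (fun r : ℝ => r ^ j) 1 := by
  rw [fwdDiff_iter_eq_sum_shift]
  refine Finset.sum_congr rfl fun k _ => ?_
  simp only [zsmul_eq_mul, nsmul_eq_mul, mul_one]
  push_cast
  ring

/-- Abel's identity: both sides are Appell sequences, and for `M > 0` both vanish at `-1`, the left
one as an `M`-th difference of a power of degree `M - 1`. -/
theorem abelSum_pow_pred (M : ℕ) (z : ℝ) :
    abelSum (fun k => ((k : ℝ) + 1) ^ (k - 1)) M z = (z + 1) ^ M := by
  refine appell_unique (f := abelSum fun k => ((k : ℝ) + 1) ^ (k - 1))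
    (g := fun M z => (z + 1) ^ M) (-1) (by simp [abelSum]) (hasDerivAt_abelSum _) ?_ ?_ M z
  · intro M z
    simpa using ((hasDerivAt_id z).add_const (1 : ℝ)).fun_pow (M + 1)
  · rintro (_ | M)
    · simp [abelSum]
    · have h := sum_choose_neg_pow_mul (M + 1) M
      rw [fwdDiff_iter_pow_eq_zero_of_lt (Nat.lt_succ_self M)] at h
      simp only [neg_add_cancel, ne_eq, Nat.succ_ne_zero, not_false_eq_true, zero_pow]
      rw [Pi.zero_apply] at h
      rw [← h, abelSum]
      refine Finset.sum_congr rfl fun k hk => ?_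
      rw [show (-1 - (k : ℝ)) = (-1) * (k + 1) by ring, mul_pow]
      rcases k with _ | k
      · simp
      · have : M = (k + 1 - 1) + (M + 1 - (k + 1)) := by
          have := Finset.mem_range.1 hk
          omega
        conv_rhs => rw [this, pow_add]
        rw [← this]
        ring

/-- Both sides are Appell sequences with value `M !` at `-1`. The truncated exponential series on
the right is the source of the Poisson probability. -/
theorem abelSum_pow (M : ℕ) (z : ℝ) :
    abelSum (fun k => ((k : ℝ) + 1) ^ k) M z
      = ∑ k ∈ Finset.range (M + 1), (M ! : ℝ) / (k ! : ℝ) * (z + 1) ^ k := by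
  refine appell_unique (f := abelSum fun k => ((k : ℝ) + 1) ^ k)
    (g := fun M z => ∑ k ∈ Finset.range (M + 1), (M ! : ℝ) / (k ! : ℝ) * (z + 1) ^ k)
    (-1) (by simp [abelSum]) (hasDerivAt_abelSum _) ?_ ?_ M z
  · intro M z
    have key : ((M : ℝ) + 1) * ∑ k ∈ Finset.range (M + 1), (M ! : ℝ) / (k ! : ℝ) * (z + 1) ^ k
        = ∑ k ∈ Finset.range (M + 1 + 1), ((M + 1)! : ℝ) / (k ! : ℝ) *
          ((k : ℝ) * (z + 1) ^ (k - 1)) := by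
      rw [Finset.sum_range_succ' _ (M + 1), Finset.mul_sum]
      simp only [Nat.cast_zero, zero_mul, mul_zero, add_zero]
      refine Finset.sum_congr rfl fun k hk => ?_
      have h1 : (k ! : ℝ) ≠ 0 := by positivity
      have h2 : (k : ℝ) + 1 ≠ 0 := by positivity
      simp only [Nat.factorial_succ, Nat.add_sub_cancel]
      push_cast
      field_simp
    rw [key]
    refine HasDerivAt.fun_sum fun k _ => HasDerivAt.const_mul _ ?_
    simpa using ((hasDerivAt_id z).add_const (1 : ℝ)).fun_pow k
  · intro M
    have h := sum_choose_neg_pow_mul M M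
    rw [fwdDiff_iter_eq_factorial] at h
    have e : ∑ k ∈ Finset.range (M + 1), (M ! : ℝ) / (k ! : ℝ) * (-1 + 1) ^ k = M ! := by
      rw [Finset.sum_range_succ']
      simp
    rw [e, abelSum]
    simp only [Pi.natCast_apply] at h
    rw [← h]
    refine Finset.sum_congr rfl fun k hk => ?_
    rw [show (-1 - (k : ℝ)) = (-1) * (k + 1) by ring, mul_pow]
    have : M = k + (M - k) := by
      have := Finset.mem_range.1 hk
      omega
    conv_rhs => rw [this, pow_add]
    rw [← this]
    ring

/-! ### Numbers of parking functions -/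

/-- The number of parking functions of `M` cars on a street with `n` spots, for `M ≤ n`. -/
noncomputable def lineCount (n M : ℕ) : ℝ := ((n : ℝ) + 1) ^ M - M * ((n : ℝ) + 1) ^ (M - 1)

theorem lineCount_succ (n M : ℕ) :
    lineCount n (M + 1) = ((n : ℝ) - M) * ((n : ℝ) + 1) ^ M := by
  simp [lineCount, pow_succ]
  ring

theorem lineCount_self (n : ℕ) : lineCount n n = ((n : ℝ) + 1) ^ (n - 1) := by
  rcases n with _ | n
  · simp [lineCount]
  · rw [lineCount_succ]; simp

/-- This is Abel's identity at `z = n + 1` minus its derivative there, matching the two terms of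
`lineCount`. -/
theorem sum_choose_mul_lineCount (n M : ℕ) (h : M ≤ n) :
    ∑ k ∈ Finset.range (M + 1),
      (M.choose k : ℝ) * lineCount k k * lineCount (n - k) (M - k) =
      lineCount (n + 1) M := by
  rw [lineCount, show (((n + 1 : ℕ) : ℝ) + 1) = n + 2 by push_cast; ring]
  have e1 := abelSum_pow_pred M ((n : ℝ) + 1)
  rw [show (n : ℝ) + 1 + 1 = n + 2 by ring] at e1
  rw [← e1]
  have e2 : (M : ℝ) * ((n : ℝ) + 2) ^ (M - 1) = ∑ k ∈ Finset.range (M + 1), (M.choose k : ℝ) *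
      ((k : ℝ) + 1) ^ (k - 1) * (((M - k : ℕ) : ℝ) * ((n : ℝ) + 1 - k) ^ (M - k - 1)) := by
    rcases M with _ | M
    · simp
    · have := abelSum_pow_pred M ((n : ℝ) + 1)
      -- The derivative of the Abel sum, computed by the Appell rule and term by term.
      have h2 := (hasDerivAt_abelSum (fun k => ((k : ℝ) + 1) ^ (k - 1)) M ((n : ℝ) + 1)).unique
        (f := abelSum (fun k => ((k : ℝ) + 1) ^ (k - 1)) (M + 1))
        (HasDerivAt.fun_sum fun k _ => HasDerivAt.const_mul _
          (((hasDerivAt_id ((n : ℝ) + 1)).sub_const (k : ℝ)).fun_pow (M + 1 - k)))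
      rw [this] at h2
      simp only [id, mul_one] at h2
      rw [← h2]
      push_cast
      simp
      left
      ring
  rw [e2, abelSum, ← Finset.sum_sub_distrib]
  refine Finset.sum_congr rfl fun k hk => ?_
  have hk' : k ≤ n := by
    have := Finset.mem_range.1 hk
    omega
  rw [lineCount_self, lineCount, Nat.cast_sub hk']
  rw [show (n : ℝ) - k + 1 = n + 1 - k by ring]
  ring

/-! ### Weights of outcomes and independence across a free spot -/

/-- The number of consecutive occupied spots directly behind spot `s`. -/
def leftRun (O : Finset ℕ) (s : ℕ) : ℕ := {a ∈ O | a < s ∧ Finset.Ico a s ⊆ O}.card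

/-- The number of consecutive occupied spots directly ahead of spot `s`. -/
def rightRun (O : Finset ℕ) (s : ℕ) : ℕ := {b ∈ O | s < b ∧ Finset.Ioc s b ⊆ O}.card

/-- The expected number of preferences that make a car park in the free spot `s`. -/
noncomputable def spotWeight (p : ℝ) (O : Finset ℕ) (s : ℕ) : ℝ :=
  1 + p * leftRun O s + (1 - p) * rightRun O s

/-- The expected number of preference lists of `k` cars that fill exactly the spots in `S`. -/
noncomputable def outcomeWeight (p : ℝ) : ℕ → Finset ℕ → ℝ
  | 0, S => if S = ∅ then 1 else 0
  | k + 1, S => ∑ s ∈ S, outcomeWeight p k (S.erase s) * spotWeight p (S.erase s) s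

theorem outcomeWeight_empty (p : ℝ) : outcomeWeight p 0 ∅ = 1 := by simp [outcomeWeight]

theorem outcomeWeight_succ (p : ℝ) (k : ℕ) (S : Finset ℕ) :
    outcomeWeight p (k + 1) S
      = ∑ s ∈ S, outcomeWeight p k (S.erase s) * spotWeight p (S.erase s) s := rfl

theorem outcomeWeight_eq_zero (p : ℝ) {k : ℕ} {S : Finset ℕ} (h : S.card ≠ k) :
    outcomeWeight p k S = 0 := by
  induction k generalizing S with
  | zero => simpa [outcomeWeight] using h
  | succ k ih =>
    rw [outcomeWeight]
    refine Finset.sum_eq_zero fun s hs => ?_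
    rw [ih, zero_mul]
    have := Finset.card_erase_add_one hs
    omega

theorem outcomeWeight_nonneg {p : ℝ} (h0 : 0 ≤ p) (h1 : p ≤ 1) (k : ℕ) (S : Finset ℕ) :
    0 ≤ outcomeWeight p k S := by
  induction k generalizing S with
  | zero => rw [outcomeWeight]; split_ifs <;> norm_num
  | succ k ih =>
    rw [outcomeWeight]
    refine Finset.sum_nonneg fun s _ => mul_nonneg (ih _) ?_
    have : 0 ≤ 1 - p := by linarith
    unfold spotWeight
    positivity

theorem spotWeight_union_left (p : ℝ) {A B : Finset ℕ} {i s : ℕ} (hA : ∀ x ∈ A, x < i)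
    (hB : ∀ x ∈ B, i < x) (hs : s < i) : spotWeight p (A ∪ B) s = spotWeight p A s := by
  have h1 : leftRun (A ∪ B) s = leftRun A s := by
    unfold leftRun
    congr 1
    ext a
    simp only [Finset.mem_filter, Finset.mem_union, Finset.subset_iff, Finset.mem_Ico]
    constructor
    · rintro ⟨h, has, h'⟩
      refine ⟨h.resolve_right fun hb => ?_, has, fun x hx => (h' hx).resolve_right fun hb => ?_⟩
      · have := hB _ hb; omega
      · have := hB _ hb; omega
    · rintro ⟨h, has, h'⟩
      exact ⟨Or.inl h, has, fun x hx => Or.inl (h' hx)⟩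
  have h2 : rightRun (A ∪ B) s = rightRun A s := by
    unfold rightRun
    congr 1
    ext b
    simp only [Finset.mem_filter, Finset.mem_union, Finset.subset_iff, Finset.mem_Ioc]
    constructor
    · rintro ⟨h, hsb, h'⟩
      -- A run reaching `i` or beyond would contain `i`, which lies in neither part.
      have hbi : b < i := by
        by_contra hbi
        rcases h' (show s < i ∧ i ≤ b by omega) with h | h
        · exact lt_irrefl _ (hA _ h)
        · exact lt_irrefl _ (hB _ h)
      refine ⟨h.resolve_right fun hb => ?_, hsb, fun x hx => (h' hx).resolve_right fun hb => ?_⟩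
      · have := hB _ hb; omega
      · have := hB _ hb; omega
    · rintro ⟨h, hsb, h'⟩
      exact ⟨Or.inl h, hsb, fun x hx => Or.inl (h' hx)⟩
  rw [spotWeight, spotWeight, h1, h2]

theorem spotWeight_union_right (p : ℝ) {A B : Finset ℕ} {i s : ℕ} (hA : ∀ x ∈ A, x < i)
    (hB : ∀ x ∈ B, i < x) (hs : i < s) : spotWeight p (A ∪ B) s = spotWeight p B s := by
  have h1 : rightRun (A ∪ B) s = rightRun B s := by
    unfold rightRun
    congr 1
    ext a
    simp only [Finset.mem_filter, Finset.mem_union, Finset.subset_iff, Finset.mem_Ioc]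
    constructor
    · rintro ⟨h, has, h'⟩
      refine ⟨h.resolve_left fun hb => ?_, has, fun x hx => (h' hx).resolve_left fun hb => ?_⟩
      · have := hA _ hb; omega
      · have := hA _ hb; omega
    · rintro ⟨h, has, h'⟩
      exact ⟨Or.inr h, has, fun x hx => Or.inr (h' hx)⟩
  have h2 : leftRun (A ∪ B) s = leftRun B s := by
    unfold leftRun
    congr 1
    ext b
    simp only [Finset.mem_filter, Finset.mem_union, Finset.subset_iff, Finset.mem_Ico]
    constructor
    · rintro ⟨h, hsb, h'⟩
      have hbi : i < b := by
        by_contra hbi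
        rcases h' (show b ≤ i ∧ i < s by omega) with h | h
        · exact lt_irrefl _ (hA _ h)
        · exact lt_irrefl _ (hB _ h)
      refine ⟨h.resolve_left fun hb => ?_, hsb, fun x hx => (h' hx).resolve_left fun hb => ?_⟩
      · have := hA _ hb; omega
      · have := hA _ hb; omega
    · rintro ⟨h, hsb, h'⟩
      exact ⟨Or.inr h, hsb, fun x hx => Or.inr (h' hx)⟩
  rw [spotWeight, spotWeight, h1, h2]

theorem disjoint_of_gap {A B : Finset ℕ} {i : ℕ} (hA : ∀ x ∈ A, x < i) (hB : ∀ x ∈ B, i < x) :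
    Disjoint A B :=
  Finset.disjoint_left.2 fun x hx hx' => lt_asymm (hA x hx) (hB x hx')

/-- The parts of the street on both sides of a free spot evolve independently. -/
theorem outcomeWeight_union (p : ℝ) {A B : Finset ℕ} {i : ℕ} (hA : ∀ x ∈ A, x < i)
    (hB : ∀ x ∈ B, i < x) (a b : ℕ) (ha : A.card = a) (hb : B.card = b) :
    outcomeWeight p (a + b) (A ∪ B)
      = ((a + b).choose a : ℝ) * outcomeWeight p a A * outcomeWeight p b B := by
  induction h : a + b generalizing A B a b with
  | zero =>
    obtain ⟨rfl, rfl⟩ : a = 0 ∧ b = 0 := by omega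
    rw [Finset.card_eq_zero] at ha hb
    subst ha hb
    simp [outcomeWeight]
  | succ t ih =>
    rcases a with _ | a
    · rw [Finset.card_eq_zero] at ha
      subst ha
      obtain rfl : b = t + 1 := by omega
      simp [outcomeWeight_empty]
    rcases b with _ | b
    · rw [Finset.card_eq_zero] at hb
      subst hb
      obtain rfl : a = t := by omega
      simp [outcomeWeight_empty]
    rw [outcomeWeight, Finset.sum_union (disjoint_of_gap hA hB)]
    have e1 : ∑ s ∈ A, outcomeWeight p t ((A ∪ B).erase s) * spotWeight p ((A ∪ B).erase s) s
        = (t.choose a : ℝ) * outcomeWeight p (a + 1) A * outcomeWeight p (b + 1) B := by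
      rw [outcomeWeight, Finset.mul_sum, Finset.sum_mul]
      refine Finset.sum_congr rfl fun s hs => ?_
      have hsB : s ∉ B := fun h => lt_asymm (hA s hs) (hB s h)
      rw [Finset.erase_union_distrib, Finset.erase_eq_of_notMem hsB]
      have hA' : ∀ x ∈ A.erase s, x < i := fun x hx => hA x (Finset.mem_of_mem_erase hx)
      rw [ih hA' hB a (b + 1) (by rw [Finset.card_erase_of_mem hs, ha]; rfl) hb (by omega),
        spotWeight_union_left p hA' hB (hA s hs)]
      ring
    have e2 : ∑ s ∈ B, outcomeWeight p t ((A ∪ B).erase s) * spotWeight p ((A ∪ B).erase s) s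
        = (t.choose (a + 1) : ℝ) * outcomeWeight p (a + 1) A * outcomeWeight p (b + 1) B := by
      rw [outcomeWeight_succ p b, Finset.mul_sum]
      refine Finset.sum_congr rfl fun s hs => ?_
      have hsA : s ∉ A := fun h => lt_asymm (hA s h) (hB s hs)
      rw [Finset.erase_union_distrib, Finset.erase_eq_of_notMem hsA]
      have hB' : ∀ x ∈ B.erase s, i < x := fun x hx => hB x (Finset.mem_of_mem_erase hx)
      rw [ih hA hB' (a + 1) b ha (by rw [Finset.card_erase_of_mem hs, hb]; rfl) (by omega),
        spotWeight_union_right p hA hB' (hB s hs)]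
      ring
    -- Pascal's rule: the last car parks on one side of `i` or on the other.
    rw [e1, e2, Nat.choose_succ_succ]
    push_cast
    ring

theorem Ico_erase_eq_union {lo k i : ℕ} (hi : i < k) :
    (Finset.Ico lo (lo + k)).erase (lo + i)
      = Finset.Ico lo (lo + i) ∪ Finset.Ico (lo + i + 1) (lo + k) := by
  ext x
  simp only [Finset.mem_erase, Finset.mem_union, Finset.mem_Ico]
  omega

theorem spotWeight_interval (p : ℝ) {lo k i : ℕ} (hi : i ≤ k) :
    spotWeight p (Finset.Ico lo (lo + i) ∪ Finset.Ico (lo + i + 1) (lo + (k + 1))) (lo + i)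
      = 1 + p * i + (1 - p) * ((k - i : ℕ) : ℝ) := by
  have h1 : leftRun (Finset.Ico lo (lo + i) ∪ Finset.Ico (lo + i + 1) (lo + (k + 1))) (lo + i)
      = i := by
    have : {a ∈ Finset.Ico lo (lo + i) ∪ Finset.Ico (lo + i + 1) (lo + (k + 1)) | a < lo + i ∧
        Finset.Ico a (lo + i) ⊆ Finset.Ico lo (lo + i) ∪ Finset.Ico (lo + i + 1) (lo + (k + 1))}
        = Finset.Ico lo (lo + i) := by
      ext a
      simp only [Finset.mem_filter, Finset.mem_union, Finset.mem_Ico, Finset.subset_iff]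
      constructor
      · omega
      · intro h
        exact ⟨Or.inl h, h.2, fun x hx => by omega⟩
    rw [leftRun, this]
    simp
  have h2 : rightRun (Finset.Ico lo (lo + i) ∪ Finset.Ico (lo + i + 1) (lo + (k + 1))) (lo + i)
      = k - i := by
    have : {a ∈ Finset.Ico lo (lo + i) ∪ Finset.Ico (lo + i + 1) (lo + (k + 1)) | lo + i < a ∧
        Finset.Ioc (lo + i) a ⊆ Finset.Ico lo (lo + i) ∪ Finset.Ico (lo + i + 1) (lo + (k + 1))}
        = Finset.Ico (lo + i + 1) (lo + (k + 1)) := by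
      ext a
      simp only [Finset.mem_filter, Finset.mem_union, Finset.mem_Ico, Finset.subset_iff,
        Finset.mem_Ioc]
      constructor
      · omega
      · intro h
        exact ⟨Or.inr h, by omega, fun x hx => by omega⟩
    rw [rightRun, this]
    simp
    omega
  rw [spotWeight, h1, h2]

/-- The weights are symmetric under `i ↦ k - i`, so `i` and `k - i` both average to `k / 2` and `p`
cancels. -/
theorem sum_interval_spotWeight (p : ℝ) (k : ℕ) :
    ∑ i ∈ Finset.range (k + 1), (k.choose i : ℝ) * lineCount i i * lineCount (k - i) (k - i)
      * (1 + p * i + (1 - p) * ((k - i : ℕ) : ℝ)) = lineCount (k + 1) (k + 1) := by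
  set u : ℕ → ℝ := fun i => (k.choose i : ℝ) * lineCount i i * lineCount (k - i) (k - i) with hu
  have hs : ∑ i ∈ Finset.range (k + 1), u i = lineCount (k + 1) k :=
    sum_choose_mul_lineCount k k le_rfl
  have hr : ∑ i ∈ Finset.range (k + 1), u i * ((k - i : ℕ) : ℝ)
      = ∑ i ∈ Finset.range (k + 1), u i * i := by
    rw [← Finset.sum_range_reflect]
    refine Finset.sum_congr rfl fun i hi => ?_
    have hi' : i ≤ k := by have := Finset.mem_range.1 hi; omega
    simp only [hu, Nat.add_sub_cancel, Nat.choose_symm hi', Nat.sub_sub_self hi']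
    ring
  have ht : ∑ i ∈ Finset.range (k + 1), u i * ((k - i : ℕ) : ℝ)
      + ∑ i ∈ Finset.range (k + 1), u i * i = k * lineCount (k + 1) k := by
    rw [← Finset.sum_add_distrib, ← hs, Finset.mul_sum]
    refine Finset.sum_congr rfl fun i hi => ?_
    have hi' : i ≤ k := by have := Finset.mem_range.1 hi; omega
    rw [Nat.cast_sub hi']
    ring
  have e : ∑ i ∈ Finset.range (k + 1), u i * (1 + p * i + (1 - p) * ((k - i : ℕ) : ℝ))
      = ∑ i ∈ Finset.range (k + 1), u i + p * ∑ i ∈ Finset.range (k + 1), u i * i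
        + (1 - p) * ∑ i ∈ Finset.range (k + 1), u i * ((k - i : ℕ) : ℝ) := by
    rw [Finset.mul_sum, Finset.mul_sum, ← Finset.sum_add_distrib, ← Finset.sum_add_distrib]
    refine Finset.sum_congr rfl fun i _ => ?_
    ring
  have f : ((k : ℝ) / 2 + 1) * lineCount (k + 1) k = lineCount (k + 1) (k + 1) := by
    rcases k with _ | k
    · simp [lineCount]
    · rw [lineCount_succ, lineCount_succ]
      push_cast
      ring
  rw [e, ← f, hs]
  linear_combination 1 / 2 * ht + (1 / 2 - p) * hr

/-- Removing the last spot filled leaves two shorter full intervals, to which induction applies. -/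
theorem outcomeWeight_interval (p : ℝ) (lo k : ℕ) :
    outcomeWeight p k (Finset.Ico lo (lo + k)) = lineCount k k := by
  induction k using Nat.strong_induction_on generalizing lo with
  | _ k ih =>
    rcases k with _ | k
    · simp [outcomeWeight, lineCount]
    · rw [outcomeWeight, Finset.sum_Ico_eq_sum_range, ← sum_interval_spotWeight p k,
        Nat.add_sub_cancel_left]
      refine Finset.sum_congr rfl fun i hi => ?_
      have hi' : i ≤ k := by have := Finset.mem_range.1 hi; omega
      rw [Ico_erase_eq_union (by omega), spotWeight_interval p hi']
      congr 1
      have hu := outcomeWeight_union p (A := Finset.Ico lo (lo + i))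
        (B := Finset.Ico (lo + i + 1) (lo + (k + 1))) (i := lo + i)
        (fun x hx => (Finset.mem_Ico.1 hx).2)
        (fun x hx => (Finset.mem_Ico.1 hx).1) i (k - i) (by simp) (by simp; omega)
      rw [Nat.add_sub_cancel' hi', ih i (by omega) lo,
        show lo + (k + 1) = lo + i + 1 + (k - i) by omega, ih (k - i) (by omega)] at hu
      rw [← hu, show lo + (k + 1) = lo + i + 1 + (k - i) by omega]

/-! ### Decomposition at the first or last free spot -/

theorem sum_powersetCard_insert {β : Type*} [AddCommMonoid β] {x : ℕ} {s : Finset ℕ} (h : x ∉ s)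
    (M : ℕ) (f : Finset ℕ → β) :
    ∑ S ∈ (insert x s).powersetCard (M + 1), f S
      = ∑ S ∈ s.powersetCard M, f (insert x S) + ∑ S ∈ s.powersetCard (M + 1), f S := by
  have hx : ∀ {k} {S : Finset ℕ}, S ∈ s.powersetCard k → x ∉ S := fun hS hxS =>
    h ((Finset.mem_powersetCard.1 hS).1 hxS)
  rw [Finset.powersetCard_succ_insert h, Finset.sum_union, add_comm, Finset.sum_image]
  · intro S hS T hT hST
    rw [← Finset.erase_insert (hx hS), ← Finset.erase_insert (hx hT), hST]
  · rw [Finset.disjoint_left]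
    intro S hS hS'
    obtain ⟨T, -, rfl⟩ := Finset.mem_image.1 hS'
    exact hx hS (Finset.mem_insert_self _ _)

/-- Decomposition of a set of occupied spots at its first free spot. -/
theorem sum_powersetCard_first_free {β : Type*} [AddCommMonoid β] (lo n M : ℕ) (h : M < n)
    (f : Finset ℕ → β) :
    ∑ S ∈ (Finset.Ico lo (lo + n)).powersetCard M, f S
      = ∑ k ∈ Finset.range (M + 1),
        ∑ B ∈ (Finset.Ico (lo + k + 1) (lo + n)).powersetCard (M - k),
          f (Finset.Ico lo (lo + k) ∪ B) := by
  induction M generalizing lo n f with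
  | zero => simp
  | succ M ih =>
    obtain ⟨n, rfl⟩ : ∃ n', n = n' + 1 := ⟨n - 1, by omega⟩
    have e : lo + (n + 1) = lo + 1 + n := by omega
    rw [← Finset.insert_Ico_add_one_left_eq_Ico (by omega : lo < lo + (n + 1)),
      sum_powersetCard_insert (by simp), Finset.sum_range_succ' _ (M + 1), e,
      ih (lo + 1) n (by omega)]
    congr 1
    · refine Finset.sum_congr rfl fun k _ => ?_
      rw [show lo + 1 + k + 1 = lo + (k + 1) + 1 by omega, show M + 1 - (k + 1) = M - k by omega]
      refine Finset.sum_congr rfl fun B _ => ?_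
      rw [← Finset.insert_union, show lo + 1 + k = lo + (k + 1) by omega,
        Finset.insert_Ico_add_one_left_eq_Ico (by omega)]
    · simp

/-- Decomposition of a set of occupied spots at its last free spot. -/
theorem sum_powersetCard_last_free {β : Type*} [AddCommMonoid β] (lo n M : ℕ) (h : M < n)
    (f : Finset ℕ → β) :
    ∑ S ∈ (Finset.Ico lo (lo + n)).powersetCard M, f S
      = ∑ k ∈ Finset.range (M + 1),
        ∑ B ∈ (Finset.Ico lo (lo + (n - k - 1))).powersetCard (M - k),
          f (B ∪ Finset.Ico (lo + (n - k)) (lo + n)) := by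
  induction M generalizing n f with
  | zero => simp
  | succ M ih =>
    obtain ⟨n, rfl⟩ : ∃ n', n = n' + 1 := ⟨n - 1, by omega⟩
    have e : lo + (n + 1) = lo + n + 1 := by omega
    rw [e, ← Finset.insert_Ico_right_eq_Ico_add_one (by omega : lo ≤ lo + n),
      sum_powersetCard_insert (by simp), Finset.sum_range_succ' _ (M + 1), ih n (by omega)]
    congr 1
    · refine Finset.sum_congr rfl fun k hk => ?_
      have := Finset.mem_range.1 hk
      rw [show n + 1 - (k + 1) - 1 = n - k - 1 by omega, show M + 1 - (k + 1) = M - k by omega]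
      refine Finset.sum_congr rfl fun B _ => ?_
      rw [← Finset.union_insert, show n + 1 - (k + 1) = n - k by omega,
        Finset.insert_Ico_right_eq_Ico_add_one (by omega)]
    · simp

theorem outcomeWeight_first_free (p : ℝ) {lo n M k : ℕ} (hk : k ≤ M) {B : Finset ℕ}
    (hB : B ∈ (Finset.Ico (lo + k + 1) (lo + n)).powersetCard (M - k)) :
    outcomeWeight p M (Finset.Ico lo (lo + k) ∪ B)
      = (M.choose k : ℝ) * lineCount k k * outcomeWeight p (M - k) B := by
  obtain ⟨hB, hc⟩ := Finset.mem_powersetCard.1 hB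
  have := outcomeWeight_union p (A := Finset.Ico lo (lo + k)) (i := lo + k)
    (fun x hx => (Finset.mem_Ico.1 hx).2) (fun x hx => (Finset.mem_Ico.1 (hB hx)).1) k (M - k)
    (by simp) hc
  rwa [Nat.add_sub_cancel' hk, outcomeWeight_interval] at this

theorem outcomeWeight_last_free (p : ℝ) {lo n M k : ℕ} (hk : k ≤ M) (hM : M < n) {B : Finset ℕ}
    (hB : B ∈ (Finset.Ico lo (lo + (n - k - 1))).powersetCard (M - k)) :
    outcomeWeight p M (B ∪ Finset.Ico (lo + (n - k)) (lo + n))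
      = (M.choose k : ℝ) * lineCount k k * outcomeWeight p (M - k) B := by
  obtain ⟨hB, hc⟩ := Finset.mem_powersetCard.1 hB
  have := outcomeWeight_union p (B := Finset.Ico (lo + (n - k)) (lo + n)) (i := lo + (n - k - 1))
    (fun x hx => (Finset.mem_Ico.1 (hB hx)).2)
    (fun x hx => by have := (Finset.mem_Ico.1 hx).1; omega) (M - k) k hc (by simp; omega)
  rw [Nat.sub_add_cancel hk, Nat.choose_symm hk, show lo + n = lo + (n - k) + k by omega,
    outcomeWeight_interval] at this
  rw [show lo + n = lo + (n - k) + k by omega, this]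
  ring

/-- The total weight of all outcomes for `M` cars on a street of `n` spots. -/
theorem sum_outcomeWeight (p : ℝ) (lo n M : ℕ) (h : M ≤ n) :
    ∑ S ∈ (Finset.Ico lo (lo + n)).powersetCard M, outcomeWeight p M S = lineCount n M := by
  induction n using Nat.strong_induction_on generalizing lo M with
  | _ n ih =>
    rcases h.eq_or_lt with rfl | h
    · have : (Finset.Ico lo (lo + M)).powersetCard M = {Finset.Ico lo (lo + M)} := by
        simpa using Finset.powersetCard_self (Finset.Ico lo (lo + M))
      rw [this, Finset.sum_singleton, outcomeWeight_interval]
    · obtain ⟨n, rfl⟩ : ∃ n', n = n' + 1 := ⟨n - 1, by omega⟩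
      -- The block before the first free spot has known weight; the rest is a shorter street.
      rw [sum_powersetCard_first_free _ _ _ h, ← sum_choose_mul_lineCount n M (by omega)]
      refine Finset.sum_congr rfl fun k hk => ?_
      have hk' : k ≤ M := by have := Finset.mem_range.1 hk; omega
      rw [Finset.sum_congr rfl fun B hB => outcomeWeight_first_free p hk' hB, ← Finset.mul_sum,
        show lo + (n + 1) = lo + k + 1 + (n - k) by omega, ih (n - k) (by omega) _ _ (by omega)]

/-! ### Outcomes that make the last car fail -/

/-- The weight of the outcomes in which the spots `0, …, j` are all occupied. -/
noncomputable def headWeight (p : ℝ) (n M j : ℕ) : ℝ :=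
  ∑ S ∈ (Finset.range n).powersetCard M,
    outcomeWeight p M S * if Finset.range (j + 1) ⊆ S then 1 else 0

/-- The weight of the outcomes in which the spots `j, …, n - 1` are all occupied. -/
noncomputable def tailWeight (p : ℝ) (n M j : ℕ) : ℝ :=
  ∑ S ∈ (Finset.range n).powersetCard M,
    outcomeWeight p M S * if Finset.Ico j n ⊆ S then 1 else 0

theorem headWeight_nonneg {p : ℝ} (h0 : 0 ≤ p) (h1 : p ≤ 1) (n M j : ℕ) :
    0 ≤ headWeight p n M j :=
  Finset.sum_nonneg fun S _ => mul_nonneg (outcomeWeight_nonneg h0 h1 M S) (by split_ifs <;> simp)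

theorem tailWeight_nonneg {p : ℝ} (h0 : 0 ≤ p) (h1 : p ≤ 1) (n M j : ℕ) :
    0 ≤ tailWeight p n M j :=
  Finset.sum_nonneg fun S _ => mul_nonneg (outcomeWeight_nonneg h0 h1 M S) (by split_ifs <;> simp)

theorem tailWeight_zero (p : ℝ) {n M : ℕ} (h : M < n) : tailWeight p n M 0 = 0 := by
  refine Finset.sum_eq_zero fun S hS => ?_
  rw [if_neg, mul_zero]
  intro hs
  have := Finset.card_le_card hs
  rw [(Finset.mem_powersetCard.1 hS).2] at this
  simp at this
  omega

/-- The outcomes leaving spot `0` free are those of the street of the remaining `n - 1` spots. -/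
theorem headWeight_zero (p : ℝ) {n M : ℕ} (h : M < n) :
    headWeight p n M 0 = lineCount n M - lineCount (n - 1) M := by
  have h1 := sum_outcomeWeight p 0 n M h.le
  have h2 := sum_outcomeWeight p 1 (n - 1) M (by omega)
  simp only [Nat.zero_add, ← Finset.range_eq_Ico] at h1
  have h3 : ∑ S ∈ (Finset.range n).powersetCard M, outcomeWeight p M S
      = headWeight p n M 0 + ∑ S ∈ (Finset.range n).powersetCard M,
        if 0 ∉ S then outcomeWeight p M S else 0 := by
    rw [headWeight, ← Finset.sum_add_distrib]
    refine Finset.sum_congr rfl fun S _ => ?_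
    by_cases hS : 0 ∈ S <;> simp [hS]
  have h4 : {S ∈ (Finset.range n).powersetCard M | 0 ∉ S}
      = (Finset.Ico 1 (1 + (n - 1))).powersetCard M := by
    ext S
    simp only [Finset.mem_filter, Finset.mem_powersetCard, Finset.subset_iff, Finset.mem_range,
      Finset.mem_Ico]
    constructor
    · rintro ⟨⟨hS, hc⟩, h0⟩
      refine ⟨fun x hx => ?_, hc⟩
      have := hS hx
      have : x ≠ 0 := fun h => h0 (h ▸ hx)
      omega
    · rintro ⟨hS, hc⟩
      refine ⟨⟨fun x hx => ?_, hc⟩, fun h0 => ?_⟩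
      · have := hS hx; omega
      · have := hS h0; omega
  rw [← Finset.sum_filter, h4] at h3
  linarith

/-- A weighted sum of `headWeight`, decomposed at the first free spot. -/
theorem sum_mul_headWeight (p : ℝ) {n M : ℕ} (h : M < n) (g : ℕ → ℝ) :
    ∑ j ∈ Finset.range n, g j * headWeight p n M j
      = ∑ k ∈ Finset.range (M + 1), (M.choose k : ℝ) * lineCount k k
        * lineCount (n - k - 1) (M - k) * ∑ j ∈ Finset.range k, g j := by
  have e : ∑ j ∈ Finset.range n, g j * headWeight p n M j
      = ∑ S ∈ (Finset.Ico 0 (0 + n)).powersetCard M, outcomeWeight p M S *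
        ∑ j ∈ Finset.range n, if Finset.range (j + 1) ⊆ S then g j else 0 := by
    simp only [headWeight, Finset.mul_sum]
    rw [Finset.sum_comm, Nat.zero_add, ← Finset.range_eq_Ico]
    refine Finset.sum_congr rfl fun S _ => Finset.sum_congr rfl fun j _ => ?_
    split_ifs <;> ring
  rw [e, sum_powersetCard_first_free _ _ _ h]
  refine Finset.sum_congr rfl fun k hk => ?_
  have hk' : k ≤ M := by have := Finset.mem_range.1 hk; omega
  rw [Finset.sum_congr rfl (g := fun B => (M.choose k : ℝ) * lineCount k k *
    outcomeWeight p (M - k) B * ∑ j ∈ Finset.range k, g j)]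
  · rw [← Finset.sum_mul, ← Finset.mul_sum, show 0 + n = 0 + k + 1 + (n - k - 1) by omega,
      sum_outcomeWeight p _ _ _ (by omega)]
  · intro B hB
    rw [outcomeWeight_first_free p hk' hB]
    congr 1
    have hB' := (Finset.mem_powersetCard.1 hB).1
    -- The spots `0, …, j` are all occupied exactly when `j` precedes the first free spot `k`.
    rw [← Finset.sum_filter]
    congr 1
    ext j
    simp only [Finset.mem_filter, Finset.mem_range, Finset.subset_iff, Finset.mem_union,
      Finset.mem_Ico]
    constructor
    · rintro ⟨-, hj⟩
      by_contra hjk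
      rcases hj (show k < j + 1 by omega) with h | h
      · omega
      · have := Finset.mem_Ico.1 (hB' h)
        omega
    · intro hj
      exact ⟨by omega, fun x hx => Or.inl (by omega)⟩

/-- A weighted sum of `tailWeight`, decomposed at the last free spot. -/
theorem sum_mul_tailWeight (p : ℝ) {n M : ℕ} (h : M < n) (g : ℕ → ℝ) :
    ∑ j ∈ Finset.range n, g j * tailWeight p n M j
      = ∑ k ∈ Finset.range (M + 1), (M.choose k : ℝ) * lineCount k k
        * lineCount (n - k - 1) (M - k) * ∑ j ∈ Finset.Ico (n - k) n, g j := by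
  have e : ∑ j ∈ Finset.range n, g j * tailWeight p n M j
      = ∑ S ∈ (Finset.Ico 0 (0 + n)).powersetCard M, outcomeWeight p M S *
        ∑ j ∈ Finset.range n, if Finset.Ico j n ⊆ S then g j else 0 := by
    simp only [tailWeight, Finset.mul_sum]
    rw [Finset.sum_comm, Nat.zero_add, ← Finset.range_eq_Ico]
    refine Finset.sum_congr rfl fun S _ => Finset.sum_congr rfl fun j _ => ?_
    split_ifs <;> ring
  rw [e, sum_powersetCard_last_free _ _ _ h]
  refine Finset.sum_congr rfl fun k hk => ?_
  have hk' : k ≤ M := by have := Finset.mem_range.1 hk; omega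
  rw [Finset.sum_congr rfl (g := fun B => (M.choose k : ℝ) * lineCount k k *
    outcomeWeight p (M - k) B * ∑ j ∈ Finset.Ico (n - k) n, g j)]
  · rw [← Finset.sum_mul, ← Finset.mul_sum, sum_outcomeWeight p _ _ _ (by omega)]
  · intro B hB
    rw [outcomeWeight_last_free p hk' h hB]
    congr 1
    have hB' := (Finset.mem_powersetCard.1 hB).1
    rw [← Finset.sum_filter]
    congr 1
    ext j
    simp only [Finset.mem_filter, Finset.mem_range, Finset.subset_iff, Finset.mem_union,
      Finset.mem_Ico]
    constructor
    · rintro ⟨hjn, hj⟩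
      by_contra hjk
      rcases hj (show j ≤ n - k - 1 ∧ n - k - 1 < n by omega) with h | h
      · have := Finset.mem_Ico.1 (hB' h)
        omega
      · omega
    · intro hj
      exact ⟨by omega, fun x hx => Or.inr (by omega)⟩

/-! ### From the parking process to outcome weights -/

/-- The probability that a coin shows `b`, where `true` means heads. -/
def coinWeight (p : ℝ) (b : Bool) : ℝ := if b then p else 1 - p

theorem occupied_snoc {m n : ℕ} (α : Fin m → Fin n) (a : Fin n) (c : Fin m → Bool) (b : Bool)
    {k : ℕ} (hk : k ≤ m) :
    occupied (Fin.snoc α a : Fin (m + 1) → Fin n) (Fin.snoc c b : Fin (m + 1) → Bool) k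
      = occupied α c k := by
  induction k with
  | zero => rfl
  | succ k ih =>
    have h1 : (⟨k, by omega⟩ : Fin (m + 1)) = Fin.castSucc ⟨k, by omega⟩ := rfl
    rw [occupied, occupied, dif_pos (by omega), dif_pos (by omega), ih (by omega), h1,
      Fin.snoc_castSucc, Fin.snoc_castSucc]

theorem occupied_snoc_last {m n : ℕ} (α : Fin m → Fin n) (a : Fin n) (c : Fin m → Bool)
    (b : Bool) :
    occupied (Fin.snoc α a : Fin (m + 1) → Fin n) (Fin.snoc c b : Fin (m + 1) → Bool) (m + 1)
      = occupied α c m ∪ (parkSpot (occupied α c m) a b).toFinset := by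
  have h1 : (⟨m, by omega⟩ : Fin (m + 1)) = Fin.last m := rfl
  rw [occupied, dif_pos (by omega), occupied_snoc α a c b le_rfl, h1, Fin.snoc_last,
    Fin.snoc_last]

theorem allPark_snoc {m n : ℕ} (α : Fin m → Fin n) (a : Fin n) (c : Fin m → Bool) (b : Bool) :
    AllPark (Fin.snoc α a : Fin (m + 1) → Fin n) (Fin.snoc c b : Fin (m + 1) → Bool)
      ↔ AllPark α c ∧ parkSpot (occupied α c m) a b ≠ none := by
  unfold AllPark
  rw [Fin.forall_fin_succ']
  refine and_congr (forall_congr' fun i => ?_) ?_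
  · rw [Fin.snoc_castSucc, Fin.snoc_castSucc, Fin.val_castSucc, occupied_snoc _ _ _ _ i.2.le]
  · rw [Fin.snoc_last, Fin.snoc_last, Fin.val_last, occupied_snoc _ _ _ _ le_rfl]

theorem sum_snoc {X : Type*} [Fintype X] {m : ℕ} (f : (Fin (m + 1) → X) → ℝ) :
    ∑ x, f x = ∑ y : Fin m → X, ∑ a, f (Fin.snoc y a) := by
  rw [← (Fin.snocEquiv fun _ : Fin (m + 1) => X).sum_comp, Fintype.sum_prod_type_right]
  rfl

open Classical in
/-- The sum of a function of the preference of the last car and of the final outcome over all the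
ways in which `k` cars can park. -/
noncomputable def parkSum (p : ℝ) (n k : ℕ) (f : (Fin k → Fin n) → Finset (Fin n) → ℝ) : ℝ :=
  ∑ α : Fin k → Fin n, ∑ c : Fin k → Bool,
    (∏ i, coinWeight p (c i)) * if AllPark α c then f α (occupied α c k) else 0

/-- The contribution of one more car to `parkSum`. -/
noncomputable def carStep (p : ℝ) {n : ℕ} (O : Finset (Fin n)) (a : Fin n)
    (g : Finset (Fin n) → ℝ) : ℝ :=
  ∑ b : Bool, coinWeight p b *
    if parkSpot O a b ≠ none then g (O ∪ (parkSpot O a b).toFinset) else 0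

theorem parkSum_succ (p : ℝ) (n k : ℕ) (f : Fin n → Finset (Fin n) → ℝ) :
    parkSum p n (k + 1) (fun α O => f (α (Fin.last k)) O)
      = parkSum p n k fun _ O => ∑ a, carStep p O a (f a) := by
  classical
  unfold parkSum carStep
  rw [sum_snoc]
  refine Finset.sum_congr rfl fun α _ => ?_
  simp_rw [sum_snoc (X := Bool)]
  rw [Finset.sum_comm]
  refine Finset.sum_congr rfl fun c _ => ?_
  by_cases h : AllPark α c
  · simp only [allPark_snoc, h, true_and, if_true, Fin.prod_univ_castSucc, Fin.snoc_castSucc,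
      Fin.snoc_last, occupied_snoc_last, Finset.mul_sum, mul_assoc]
  · simp [allPark_snoc, h]

theorem parkSpot_true_eq_some {n : ℕ} {O : Finset (Fin n)} {a s : Fin n} :
    parkSpot O a true = some s ↔
      (a ∉ O ∧ a = s) ∨ (a ∈ O ∧ a < s ∧ s ∉ O ∧ ∀ b, a < b → b < s → b ∈ O) := by
  unfold parkSpot
  by_cases ha : a ∈ O
  · by_cases h : (freeAhead O a).Nonempty
    · simp only [ha, not_true_eq_false, if_false, if_true, h, dif_pos, Option.some.injEq,
        false_and, true_and, false_or, Finset.min'_eq_iff]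
      simp only [freeAhead, Finset.mem_filter, Finset.mem_univ, true_and, and_assoc]
      refine and_congr_right fun _ => and_congr_right fun _ => ?_
      constructor
      · intro h b hab hbs
        by_contra hb
        exact absurd (h b ⟨hab, hb⟩) (not_le.2 hbs)
      · rintro h b ⟨hab, hb⟩
        by_contra hsb
        exact hb (h b hab (not_le.1 hsb))
    · simp only [ha, not_true_eq_false, if_false, if_true, h, dif_neg, false_and, true_and,
        false_or, not_false_eq_true, reduceCtorEq, false_iff]
      rintro ⟨h1, h2, -⟩
      exact h ⟨s, by simp [freeAhead, h1, h2]⟩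
  · simp [ha]

theorem parkSpot_false_eq_some {n : ℕ} {O : Finset (Fin n)} {a s : Fin n} :
    parkSpot O a false = some s ↔
      (a ∉ O ∧ a = s) ∨ (a ∈ O ∧ s < a ∧ s ∉ O ∧ ∀ b, s < b → b < a → b ∈ O) := by
  unfold parkSpot
  by_cases ha : a ∈ O
  · by_cases h : (freeBehind O a).Nonempty
    · simp only [ha, not_true_eq_false, if_false, h, dif_pos, Option.some.injEq,
        false_and, true_and, false_or, Finset.max'_eq_iff, reduceCtorEq]
      simp only [freeBehind, Finset.mem_filter, Finset.mem_univ, true_and, and_assoc]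
      refine and_congr_right fun _ => and_congr_right fun _ => ?_
      constructor
      · intro h b hab hbs
        by_contra hb
        exact absurd (h b ⟨hbs, hb⟩) (not_le.2 hab)
      · rintro h b ⟨hab, hb⟩
        by_contra hsb
        exact hb (h b (not_le.1 hsb) hab)
    · simp only [ha, not_true_eq_false, if_false, h, dif_neg, false_and, true_and,
        false_or, not_false_eq_true, reduceCtorEq, false_iff]
      rintro ⟨h1, h2, -⟩
      exact h ⟨s, by simp [freeBehind, h1, h2]⟩
  · simp [ha]

theorem parkSpot_true_eq_none {n : ℕ} {O : Finset (Fin n)} {a : Fin n} :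
    parkSpot O a true = none ↔ Finset.Ico a.val n ⊆ O.map Fin.valEmbedding := by
  have : parkSpot O a true = none ↔ a ∈ O ∧ ∀ b, a < b → b ∈ O := by
    unfold parkSpot
    by_cases ha : a ∈ O <;> by_cases h : (freeAhead O a).Nonempty <;> simp only [ha, h] <;>
      simp [freeAhead, Finset.filter_nonempty_iff, -Finset.not_nonempty_iff_eq_empty] at h ⊢
    · obtain ⟨b, h1, h2⟩ := h
      exact ⟨b, h1, h2⟩
    · exact h
  rw [this]
  simp only [Finset.subset_iff, Finset.mem_Ico, Finset.mem_map, Fin.valEmbedding_apply]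
  constructor
  · rintro ⟨ha, h⟩ x ⟨hx, hxn⟩
    rcases hx.eq_or_lt with rfl | hx
    · exact ⟨a, ha, rfl⟩
    · exact ⟨⟨x, hxn⟩, h _ hx, rfl⟩
  · intro h
    have key : ∀ b : Fin n, a ≤ b → b ∈ O := fun b hb => by
      obtain ⟨y, hy, hyb⟩ := h ⟨hb, b.2⟩
      rwa [← Fin.ext hyb]
    exact ⟨key a le_rfl, fun b hb => key b hb.le⟩

theorem parkSpot_false_eq_none {n : ℕ} {O : Finset (Fin n)} {a : Fin n} :
    parkSpot O a false = none ↔ Finset.range (a.val + 1) ⊆ O.map Fin.valEmbedding := by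
  have : parkSpot O a false = none ↔ a ∈ O ∧ ∀ b, b < a → b ∈ O := by
    unfold parkSpot
    by_cases ha : a ∈ O <;> by_cases h : (freeBehind O a).Nonempty <;> simp only [ha, h] <;>
      simp [freeBehind, Finset.filter_nonempty_iff, -Finset.not_nonempty_iff_eq_empty] at h ⊢
    · obtain ⟨b, h1, h2⟩ := h
      exact ⟨b, h1, h2⟩
    · exact h
  rw [this]
  simp only [Finset.subset_iff, Finset.mem_range, Finset.mem_map, Fin.valEmbedding_apply]
  constructor
  · rintro ⟨ha, h⟩ x hx
    rcases (Nat.lt_succ_iff.1 hx).eq_or_lt with rfl | hx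
    · exact ⟨a, ha, rfl⟩
    · exact ⟨⟨x, hx.trans a.2⟩, h _ hx, rfl⟩
  · intro h
    have key : ∀ b : Fin n, b ≤ a → b ∈ O := fun b hb => by
      obtain ⟨y, hy, hyb⟩ := h (Nat.lt_succ_of_le hb)
      rwa [← Fin.ext hyb]
    exact ⟨key a le_rfl, fun b hb => key b hb.le⟩

theorem card_parkSpot_true {n : ℕ} {O : Finset (Fin n)} {s : Fin n} (hs : s ∉ O) :
    {a | parkSpot O a true = some s}.ncard
      = 1 + leftRun (O.map Fin.valEmbedding) s := by
  have e : {a | parkSpot O a true = some s}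
      = ((insert s {a ∈ O | a < s ∧ ∀ b, a < b → b < s → b ∈ O} : Finset (Fin n)) : Set _) := by
    ext a
    simp only [Set.mem_ofPred_eq, parkSpot_true_eq_some, Finset.coe_insert, Finset.coe_filter,
      Set.mem_insert_iff]
    constructor
    · rintro (⟨-, h⟩ | ⟨h1, h2, -, h3⟩)
      · exact Or.inl h
      · exact Or.inr ⟨h1, h2, h3⟩
    · rintro (rfl | ⟨h1, h2, h3⟩)
      · exact Or.inl ⟨hs, rfl⟩
      · exact Or.inr ⟨h1, h2, hs, h3⟩
  rw [e, Set.ncard_coe_finset, Finset.card_insert_of_notMem (by simp), add_comm, leftRun,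
    Finset.filter_map, Finset.card_map]
  congr 2
  refine Finset.filter_congr fun a ha => and_congr Iff.rfl ?_
  simp only [Finset.subset_iff, Finset.mem_Ico, Finset.mem_map,
    Fin.valEmbedding_apply]
  constructor
  · rintro h x ⟨h1, h2⟩
    rcases h1.eq_or_lt with rfl | h1
    · exact ⟨a, ha, rfl⟩
    · exact ⟨⟨x, h2.trans s.2⟩, h _ h1 h2, rfl⟩
  · intro h b h1 h2
    obtain ⟨y, hy, hyb⟩ := h ⟨h1.le, h2⟩
    rwa [← Fin.ext hyb]

theorem card_parkSpot_false {n : ℕ} {O : Finset (Fin n)} {s : Fin n} (hs : s ∉ O) :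
    {a | parkSpot O a false = some s}.ncard
      = 1 + rightRun (O.map Fin.valEmbedding) s := by
  have e : {a | parkSpot O a false = some s}
      = ((insert s {a ∈ O | s < a ∧ ∀ b, s < b → b < a → b ∈ O} : Finset (Fin n)) : Set _) := by
    ext a
    simp only [Set.mem_ofPred_eq, parkSpot_false_eq_some, Finset.coe_insert, Finset.coe_filter,
      Set.mem_insert_iff]
    constructor
    · rintro (⟨-, h⟩ | ⟨h1, h2, -, h3⟩)
      · exact Or.inl h
      · exact Or.inr ⟨h1, h2, h3⟩
    · rintro (rfl | ⟨h1, h2, h3⟩)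
      · exact Or.inl ⟨hs, rfl⟩
      · exact Or.inr ⟨h1, h2, hs, h3⟩
  rw [e, Set.ncard_coe_finset, Finset.card_insert_of_notMem (by simp), add_comm, rightRun,
    Finset.filter_map, Finset.card_map]
  congr 2
  refine Finset.filter_congr fun a ha => and_congr Iff.rfl ?_
  simp only [Finset.subset_iff, Finset.mem_Ioc, Finset.mem_map,
    Fin.valEmbedding_apply]
  constructor
  · rintro h x ⟨h1, h2⟩
    rcases h2.eq_or_lt with rfl | h2
    · exact ⟨a, ha, rfl⟩
    · exact ⟨⟨x, h2.trans a.2⟩, h _ h1 h2, rfl⟩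
  · intro h b h1 h2
    obtain ⟨y, hy, hyb⟩ := h ⟨h1, h2.le⟩
    rwa [← Fin.ext hyb]

theorem parkSpot_notMem {n : ℕ} {O : Finset (Fin n)} {a s : Fin n} {b : Bool}
    (h : parkSpot O a b = some s) : s ∉ O := by
  cases b
  · rcases parkSpot_false_eq_some.1 h with ⟨h', rfl⟩ | ⟨_, _, h', _⟩ <;> exact h'
  · rcases parkSpot_true_eq_some.1 h with ⟨h', rfl⟩ | ⟨_, _, h', _⟩ <;> exact h'

/-- Grouping preferences by the spot `s` they lead to: heads reaches `s` from `s` itself or the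
occupied run behind it, tails from `s` or the run ahead. -/
theorem sum_carStep (p : ℝ) {n : ℕ} (O : Finset (Fin n)) (g : Finset (Fin n) → ℝ) :
    ∑ a, carStep p O a g
      = ∑ s ∈ Oᶜ, spotWeight p (O.map Fin.valEmbedding) s * g (insert s O) := by
  have h1 : ∀ a b, (if parkSpot O a b ≠ none then g (O ∪ (parkSpot O a b).toFinset) else 0)
      = ∑ s ∈ Oᶜ, if parkSpot O a b = some s then g (insert s O) else 0 := by
    intro a b
    rcases h : parkSpot O a b with _ | s
    · simp
    · have hs := parkSpot_notMem h
      simp [hs, Finset.union_singleton]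
  have h2 : ∀ (s : Fin n) (b : Bool),
      ∑ a, (if parkSpot O a b = some s then g (insert s O) else 0)
        = ({a | parkSpot O a b = some s}.ncard : ℝ) * g (insert s O) := by
    intro s b
    rw [← Finset.sum_filter, Finset.sum_const, nsmul_eq_mul, ← Set.ncard_coe_finset,
      Finset.coe_filter]
    simp
  unfold carStep
  rw [Finset.sum_comm]
  simp_rw [h1, ← Finset.mul_sum]
  simp_rw [Finset.sum_comm (s := Finset.univ) (t := Oᶜ), h2]
  simp only [Fintype.sum_bool, Finset.mul_sum]
  rw [← Finset.sum_add_distrib]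
  refine Finset.sum_congr rfl fun s hs => ?_
  rw [card_parkSpot_true (by simpa using hs), card_parkSpot_false (by simpa using hs)]
  simp [coinWeight, spotWeight]
  ring

theorem carStep_one (p : ℝ) {n : ℕ} (O : Finset (Fin n)) (a : Fin n) :
    carStep p O a (fun _ => 1)
      = 1 - p * (if Finset.Ico a.val n ⊆ O.map Fin.valEmbedding then 1 else 0)
        - (1 - p) * (if Finset.range (a.val + 1) ⊆ O.map Fin.valEmbedding then 1 else 0) := by
  unfold carStep
  simp only [Fintype.sum_bool, ne_eq, parkSpot_true_eq_none, parkSpot_false_eq_none, ite_not]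
  simp only [coinWeight, if_true, Bool.false_eq_true, if_false]
  split_ifs <;> ring

theorem sum_insert_compl {n : ℕ} (F : Finset (Fin n) → Fin n → ℝ) :
    ∑ O : Finset (Fin n), ∑ s ∈ Oᶜ, F O s
      = ∑ S : Finset (Fin n), ∑ s ∈ S, F (S.erase s) s := by
  rw [Finset.sum_sigma', Finset.sum_sigma']
  refine Finset.sum_bij' (fun x _ => ⟨insert x.2 x.1, x.2⟩) (fun x _ => ⟨x.1.erase x.2, x.2⟩)
    ?_ ?_ ?_ ?_ ?_
  · simp
  · simp
  · rintro ⟨O, s⟩ h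
    have : s ∉ O := by simpa using h
    simp [this]
  · rintro ⟨O, s⟩ h
    have : s ∈ O := by simpa using h
    simp [this]
  · rintro ⟨O, s⟩ h
    have : s ∉ O := by simpa using h
    simp [this]

/-- Peeling off the last car reproduces the recursion of `outcomeWeight`. -/
theorem parkSum_outcome (p : ℝ) (n k : ℕ) (g : Finset (Fin n) → ℝ) :
    parkSum p n k (fun _ O => g O)
      = ∑ S : Finset (Fin n), outcomeWeight p k (S.map Fin.valEmbedding) * g S := by
  induction k generalizing g with
  | zero =>
    have : ∀ (α : Fin 0 → Fin n) c, AllPark α c := fun α c i => i.elim0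
    simp [parkSum, this, outcomeWeight, occupied]
  | succ k ih =>
    rw [parkSum_succ p n k fun _ => g, ih fun O => ∑ a, carStep p O a g]
    simp_rw [sum_carStep, Finset.mul_sum]
    rw [sum_insert_compl]
    refine Finset.sum_congr rfl fun S _ => ?_
    rw [outcomeWeight, Finset.sum_map, Finset.sum_mul]
    refine Finset.sum_congr rfl fun s hs => ?_
    rw [Finset.insert_erase hs, Finset.map_erase]
    simp [mul_assoc]

theorem sum_outcome_fin (p : ℝ) (n k : ℕ) (g : Finset ℕ → ℝ) :
    ∑ S : Finset (Fin n), outcomeWeight p k (S.map Fin.valEmbedding) *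
        g (S.map Fin.valEmbedding)
      = ∑ S ∈ (Finset.range n).powersetCard k, outcomeWeight p k S * g S := by
  have h : (Finset.range n).powersetCard k = ((Finset.univ : Finset (Fin n)).powersetCard k).map
      (Finset.mapEmbedding Fin.valEmbedding).toEmbedding := by
    rw [← Finset.powersetCard_map, Fin.map_valEmbedding_univ, Nat.Iio_eq_range]
  rw [h, Finset.sum_map]
  simp only [RelEmbedding.coe_toEmbedding, Finset.mapEmbedding_apply]
  -- Sets of the wrong size carry no weight.
  refine (Finset.sum_subset (Finset.subset_univ _) fun S _ hS => ?_).symm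
  rw [outcomeWeight_eq_zero, zero_mul]
  simpa using hS

theorem parkSum_one (p : ℝ) {n k : ℕ} (h : k ≤ n) :
    parkSum p n k (fun _ _ => 1) = lineCount n k := by
  rw [parkSum_outcome p n k fun _ => 1, sum_outcome_fin p n k fun _ => 1,
    ← sum_outcomeWeight p 0 n k h, Nat.zero_add, Finset.range_eq_Ico]
  simp

theorem parkSum_last (p : ℝ) {n M : ℕ} (h : M < n) (j : Fin n) :
    parkSum p n (M + 1) (fun α _ => if α (Fin.last M) = j then 1 else 0)
      = lineCount n M - p * tailWeight p n M j - (1 - p) * headWeight p n M j := by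
  have e : ∀ O : Finset (Fin n), ∑ a, carStep p O a (fun _ => if a = j then 1 else 0)
      = carStep p O j fun _ => 1 := by
    intro O
    rw [Finset.sum_eq_single j]
    · simp
    · intro a _ ha
      simp [carStep, ha]
    · simp
  rw [parkSum_succ p n M fun a _ => if a = j then 1 else 0]
  simp_rw [e, carStep_one]
  rw [parkSum_outcome, sum_outcome_fin p n M fun S => 1
    - p * (if Finset.Ico j.val n ⊆ S then 1 else 0)
    - (1 - p) * (if Finset.range (j.val + 1) ⊆ S then 1 else 0),
    ← sum_outcomeWeight p 0 n M h.le, Nat.zero_add, ← Finset.range_eq_Ico, tailWeight, headWeight,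
    Finset.mul_sum, Finset.mul_sum, ← Finset.sum_sub_distrib, ← Finset.sum_sub_distrib]
  refine Finset.sum_congr rfl fun S _ => ?_
  ring

/-! ### The law of the last preference -/

theorem parkingMeasure_real (m n : ℕ) (hn : 0 < n) (p : unitInterval)
    (s : Set ((Fin m → Fin n) × (Fin m → Bool))) [DecidablePred (· ∈ s)] :
    (parkingMeasure m n p).real s
      = ((n : ℝ) ^ m)⁻¹ * ∑ α, ∑ c, (∏ i, coinWeight p (c i)) * if (α, c) ∈ s then 1 else 0 := by
  have : Nonempty (Fin n) := ⟨⟨0, hn⟩⟩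
  have : IsProbabilityMeasure (uniformOn (Set.univ : Set (Fin m → Fin n))) :=
    isProbabilityMeasure_uniformOn Set.finite_univ Set.univ_nonempty
  have h1 : ∀ α c, (parkingMeasure m n p).real {(α, c)}
      = ((n : ℝ) ^ m)⁻¹ * ∏ i, coinWeight p (c i) := by
    intro α c
    rw [parkingMeasure, measureReal_def, ← Set.singleton_prod_singleton, Measure.prod_prod,
      Measure.pi_singleton,
      uniformOn_univ, ENNReal.toReal_mul, ENNReal.toReal_prod]
    congr 1
    · simp
    · refine Finset.prod_congr rfl fun i _ => ?_
      rw [← measureReal_def]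
      cases c i <;> simp [coinWeight]
  have : IsProbabilityMeasure (parkingMeasure m n p) := by
    unfold parkingMeasure
    infer_instance
  have hs : s = ((Finset.univ.filter (· ∈ s) : Finset _) : Set _) := by simp
  conv_lhs => rw [hs, ← sum_measureReal_singleton]
  rw [Finset.sum_filter, Fintype.sum_prod_type, Finset.mul_sum]
  refine Finset.sum_congr rfl fun α _ => ?_
  rw [Finset.mul_sum]
  refine Finset.sum_congr rfl fun c _ => ?_
  rw [h1]
  split_ifs <;> simp

theorem lastCarLaw_real {M n : ℕ} (h : M < n) (hm : 1 ≤ M + 1) (p : unitInterval) (j : Fin n) :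
    (lastCarLaw (M + 1) n hm p).real {j}
      = (lineCount n M - p * tailWeight p n M j - (1 - p) * headWeight p n M j)
        / lineCount n (M + 1) := by
  classical
  have hA : (parkingMeasure (M + 1) n p).real (allParkEvent (M + 1) n)
      = ((n : ℝ) ^ (M + 1))⁻¹ * lineCount n (M + 1) := by
    rw [parkingMeasure_real _ _ (by omega), ← parkSum_one p h, parkSum]
    rfl
  have hB : (parkingMeasure (M + 1) n p).real
      (allParkEvent (M + 1) n ∩ (fun ω => ω.1 (Fin.last M)) ⁻¹' {j})
      = ((n : ℝ) ^ (M + 1))⁻¹ *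
        (lineCount n M - p * tailWeight p n M j - (1 - p) * headWeight p n M j) := by
    rw [parkingMeasure_real _ _ (by omega), ← parkSum_last p h j, parkSum]
    congr 1
    refine Finset.sum_congr rfl fun α _ => Finset.sum_congr rfl fun c _ => ?_
    congr 1
    simp only [allParkEvent, Set.mem_inter_iff, Set.mem_ofPred_eq, Set.mem_preimage,
      Set.mem_singleton_iff, ite_and]
  have hl : (⟨M + 1 - 1, Nat.sub_lt hm Nat.one_pos⟩ : Fin (M + 1)) = Fin.last M := rfl
  rw [lastCarLaw, hl, map_measureReal_apply (measurable_of_countable _) (measurableSet_singleton _),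
    measureReal_def, cond_apply (Set.toFinite _).measurableSet, ENNReal.toReal_mul,
    ENNReal.toReal_inv, ← measureReal_def, ← measureReal_def, hA, hB]
  have hn : (n : ℝ) ≠ 0 := by
    have : 0 < n := by omega
    positivity
  rw [mul_inv, inv_inv, div_eq_inv_mul]
  field_simp

/-- Summing `parkSum_last` over all preferences must give the total weight for `M + 1` cars. -/
theorem sum_fault_eq (p : ℝ) {n M : ℕ} (h : M < n) :
    ∑ j ∈ Finset.range n, (p * tailWeight p n M j + (1 - p) * headWeight p n M j)
      = n * lineCount n M - lineCount n (M + 1) := by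
  classical
  have e : ∑ j : Fin n, parkSum p n (M + 1) (fun α _ => if α (Fin.last M) = j then 1 else 0)
      = parkSum p n (M + 1) fun _ _ => 1 := by
    unfold parkSum
    rw [Finset.sum_comm]
    refine Finset.sum_congr rfl fun α _ => ?_
    rw [Finset.sum_comm]
    refine Finset.sum_congr rfl fun c _ => ?_
    rw [← Finset.mul_sum]
    by_cases hA : AllPark α c <;> simp [hA]
  rw [parkSum_one p h] at e
  simp_rw [parkSum_last p h] at e
  rw [Fin.sum_univ_eq_sum_range (fun j => lineCount n M - p * tailWeight p n M j
    - (1 - p) * headWeight p n M j)] at e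
  rw [← e, eq_sub_iff_add_eq, ← Finset.sum_add_distrib]
  simp

/-! ### The centred moment of the failure weights -/

theorem sum_range_centered (n k : ℕ) :
    ∑ j ∈ Finset.range k, (2 * (j : ℝ) + 1 - n) = k * ((k : ℝ) - n) := by
  induction k with
  | zero => simp
  | succ k ih => rw [Finset.sum_range_succ, ih]; push_cast; ring

theorem sum_Ico_centered {n k : ℕ} (h : k ≤ n) :
    ∑ j ∈ Finset.Ico (n - k) n, (2 * (j : ℝ) + 1 - n) = -(k * ((k : ℝ) - n)) := by
  rw [Finset.sum_Ico_eq_sub _ (Nat.sub_le n k), sum_range_centered, sum_range_centered,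
    Nat.cast_sub h]
  ring

/-- The factor `n - k` turns `lineCount (n - k - 1) (M - k)` into a multiple of `(n - k) ^ (M - k)`,
and the factor `k` gives `(k + 1) ^ k - (k + 1) ^ (k - 1)`: a difference of the two Abel sums at `z
= n`. -/
theorem sum_centered_lineCount {n M : ℕ} (h : M < n) :
    ∑ k ∈ Finset.range (M + 1), (M.choose k : ℝ) * lineCount k k
        * lineCount (n - k - 1) (M - k) * (k * ((k : ℝ) - n))
      = -((n : ℝ) - M) * (∑ k ∈ Finset.range (M + 1), (M ! : ℝ) / (k ! : ℝ) * ((n : ℝ) + 1) ^ k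
        - ((n : ℝ) + 1) ^ M) := by
  rw [← abelSum_pow, ← abelSum_pow_pred, abelSum, abelSum, ← Finset.sum_sub_distrib,
    Finset.mul_sum]
  refine Finset.sum_congr rfl fun k hk => ?_
  have hk' : k ≤ M := by have := Finset.mem_range.1 hk; omega
  have e1 : ((k : ℝ) + 1) ^ k - ((k : ℝ) + 1) ^ (k - 1) = k * ((k : ℝ) + 1) ^ (k - 1) := by
    rcases k with _ | k
    · simp
    · simp only [Nat.add_sub_cancel, pow_succ]
      push_cast
      ring
  have e2 : lineCount (n - k - 1) (M - k) * ((n : ℝ) - k)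
      = ((n : ℝ) - M) * ((n : ℝ) - k) ^ (M - k) := by
    have hc : (((n - k - 1 : ℕ) : ℝ) + 1) = n - k := by
      rw [← Nat.cast_sub (by omega), ← Nat.cast_add_one]
      congr 1
      omega
    obtain ⟨d, rfl⟩ := Nat.exists_eq_add_of_le hk'
    rw [Nat.add_sub_cancel_left, lineCount, hc]
    rcases d with _ | d
    · simp
    · simp only [Nat.add_sub_cancel, pow_succ]
      push_cast
      ring
  rw [lineCount_self]
  linear_combination (-(M.choose k : ℝ) * k * ((k : ℝ) + 1) ^ (k - 1)) * e2
    + (M.choose k : ℝ) * ((n : ℝ) - M) * ((n : ℝ) - k) ^ (M - k) * e1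

theorem sum_centered_fault (p : ℝ) {n M : ℕ} (h : M < n) :
    ∑ j ∈ Finset.range n, (2 * (j : ℝ) + 1 - n)
        * (p * tailWeight p n M j + (1 - p) * headWeight p n M j)
      = (2 * p - 1) * (((n : ℝ) - M) *
        (∑ k ∈ Finset.range (M + 1), (M ! : ℝ) / (k ! : ℝ) * ((n : ℝ) + 1) ^ k
          - ((n : ℝ) + 1) ^ M)) := by
  have e : ∑ j ∈ Finset.range n, (2 * (j : ℝ) + 1 - n)
        * (p * tailWeight p n M j + (1 - p) * headWeight p n M j)
      = p * ∑ j ∈ Finset.range n, (2 * (j : ℝ) + 1 - n) * tailWeight p n M j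
        + (1 - p) * ∑ j ∈ Finset.range n, (2 * (j : ℝ) + 1 - n) * headWeight p n M j := by
    rw [Finset.mul_sum, Finset.mul_sum, ← Finset.sum_add_distrib]
    refine Finset.sum_congr rfl fun j _ => ?_
    ring
  -- The test weights are odd under reflection of the street, which exchanges heads and tails; hence
  -- the factor `2 * p - 1`.
  have ht : ∑ j ∈ Finset.range n, (2 * (j : ℝ) + 1 - n) * tailWeight p n M j
      = -∑ j ∈ Finset.range n, (2 * (j : ℝ) + 1 - n) * headWeight p n M j := by
    rw [sum_mul_tailWeight p h fun j => 2 * (j : ℝ) + 1 - n,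
      sum_mul_headWeight p h fun j => 2 * (j : ℝ) + 1 - n, ← Finset.sum_neg_distrib]
    refine Finset.sum_congr rfl fun k hk => ?_
    rw [sum_Ico_centered (by have := Finset.mem_range.1 hk; omega), sum_range_centered]
    ring
  have hh : ∑ j ∈ Finset.range n, (2 * (j : ℝ) + 1 - n) * headWeight p n M j
      = -((n : ℝ) - M) * (∑ k ∈ Finset.range (M + 1), (M ! : ℝ) / (k ! : ℝ) * ((n : ℝ) + 1) ^ k
        - ((n : ℝ) + 1) ^ M) := by
    rw [sum_mul_headWeight p h fun j => 2 * (j : ℝ) + 1 - n, ← sum_centered_lineCount h]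
    simp_rw [sum_range_centered]
  rw [e, ht, hh]
  ring

theorem poissonMeasure_real_Iic (r : ℝ≥0) (M : ℕ) :
    (poissonMeasure r).real (Set.Iic M)
      = ∑ k ∈ Finset.range (M + 1), Real.exp (-r) * r ^ k / (k ! : ℝ) := by
  have : Set.Iic M = ((Finset.range (M + 1) : Finset ℕ) : Set ℕ) := by
    ext x
    simp
  rw [this, ← sum_measureReal_singleton]
  simp_rw [poissonMeasure_real_singleton]

theorem exp_mul_factorial_mul_poisson (n M : ℕ) :
    Real.exp ((n : ℝ) + 1) * (M ! : ℕ) * (poissonMeasure ((n : ℝ≥0) + 1)).real (Set.Iic M)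
      = ∑ k ∈ Finset.range (M + 1), (M ! : ℝ) / (k ! : ℝ) * ((n : ℝ) + 1) ^ k := by
  rw [poissonMeasure_real_Iic, Finset.mul_sum]
  refine Finset.sum_congr rfl fun k _ => ?_
  push_cast
  rw [Real.exp_neg]
  have := Real.exp_ne_zero ((n : ℝ) + 1)
  field_simp

/-! ### Total variation bounds -/

theorem uniformLaw_real {n : ℕ} (j : Fin n) : (uniformLaw n).real {j} = 1 / n := by
  rw [uniformLaw, measureReal_def, uniformOn_univ]
  simp

/-- The total variation distance in terms of the weight of the outcomes in which the last car
fails to park. -/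
theorem tvDist_lastCarLaw {M n : ℕ} (h : M < n) (hm : 1 ≤ M + 1) (p : unitInterval) :
    tvDist (lastCarLaw (M + 1) n hm p) (uniformLaw n)
      = 1 / 2 * ∑ j ∈ Finset.range n, |(lineCount n M
        - (p * tailWeight p n M j + (1 - p) * headWeight p n M j)) / lineCount n (M + 1)
        - 1 / n| := by
  rw [tvDist, ← Fin.sum_univ_eq_sum_range (fun j => |(lineCount n M
        - (p * tailWeight p n M j + (1 - p) * headWeight p n M j)) / lineCount n (M + 1)
        - 1 / n|)]
  simp_rw [lastCarLaw_real h, uniformLaw_real, sub_sub]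

theorem lineCount_succ_pos {M n : ℕ} (h : M < n) : 0 < lineCount n (M + 1) := by
  rw [lineCount_succ]
  have : (M : ℝ) < n := by exact_mod_cast h
  have : 0 < (n : ℝ) - M := by linarith
  positivity

theorem lineCount_mul (n M : ℕ) :
    lineCount n M * (n + 1) = ((n : ℝ) + 1 - M) * ((n : ℝ) + 1) ^ M := by
  rcases M with _ | M
  · simp [lineCount]
  · rw [lineCount_succ, pow_succ]
    push_cast
    ring

theorem sum_abs_le {n : ℕ} (hn : 0 < n) {F : ℕ → ℝ} {a b : ℝ} (hF : ∀ j, 0 ≤ F j) (hb : 0 < b)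
    (hs : ∑ j ∈ Finset.range n, F j = n * a - b) :
    1 / 2 * ∑ j ∈ Finset.range n, |(a - F j) / b - 1 / n| ≤ (n * a - b) / b := by
  have hn' : (0 : ℝ) < n := by exact_mod_cast hn
  have h0 : 0 ≤ n * a - b := hs ▸ Finset.sum_nonneg fun j _ => hF j
  have hj : ∀ j ∈ Finset.range n, |(a - F j) / b - 1 / n|
      ≤ ((n * a - b) / n + F j) / b := by
    intro j _
    have e : (a - F j) / b - 1 / n = ((n * a - b) / n - F j) / b := by
      field_simp
      ring
    rw [e, abs_div, abs_of_pos hb]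
    gcongr
    have h1 : 0 ≤ (n * a - b) / n := by positivity
    rw [abs_le]
    constructor <;> linarith [hF j]
  -- The mean of `F` and `F` itself have the same sum, so the factor `1 / 2` absorbs the doubling.
  calc _ ≤ 1 / 2 * ∑ j ∈ Finset.range n, ((n * a - b) / n + F j) / b := by
        gcongr with j hj'
        exact hj j hj'
    _ = (n * a - b) / b := by
        rw [← Finset.sum_div, Finset.sum_add_distrib, hs]
        simp only [Finset.sum_const, Finset.card_range, nsmul_eq_mul]
        field_simp
        ring

theorem le_sum_abs {n : ℕ} {F : ℕ → ℝ} {a b : ℝ} :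
    |(∑ j ∈ Finset.range n, (2 * (j : ℝ) + 1 - n) * F j) / b|
      ≤ n * ∑ j ∈ Finset.range n, |(a - F j) / b - 1 / n| := by
  have e : -((∑ j ∈ Finset.range n, (2 * (j : ℝ) + 1 - n) * F j) / b)
      = ∑ j ∈ Finset.range n, (2 * (j : ℝ) + 1 - n) * ((a - F j) / b - 1 / n) := by
    have h0 := sum_range_centered n n
    rw [sub_self, mul_zero] at h0
    have h1 : ∀ j : ℕ, (2 * (j : ℝ) + 1 - n) * ((a - F j) / b - 1 / n)
        = (2 * (j : ℝ) + 1 - n) * (a / b - 1 / n) - (2 * (j : ℝ) + 1 - n) * F j / b := by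
      intro j
      ring
    simp_rw [h1]
    rw [Finset.sum_sub_distrib, ← Finset.sum_mul, h0, Finset.sum_div]
    ring
  rw [← abs_neg, e, Finset.mul_sum]
  refine (Finset.abs_sum_le_sum_abs _ _).trans (Finset.sum_le_sum fun j hj => ?_)
  rw [abs_mul]
  gcongr
  have : (j : ℝ) + 1 ≤ n := by exact_mod_cast Finset.mem_range.1 hj
  rw [abs_le]
  constructor <;> linarith [(Nat.cast_nonneg j : (0 : ℝ) ≤ j)]

end ProbParking

theorem theorem3p3 (m n : ℕ) (hm : 1 ≤ m) (hmn : m ≤ n) (p : unitInterval) :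
    ProbParking.tvDist (ProbParking.lastCarLaw m n hm p) (ProbParking.uniformLaw n)
        ≤ ((m : ℝ) - 1) / (((n : ℝ) + 1) * ((n : ℝ) - m + 1)) ∧
    |2 * (p : ℝ) - 1| / (4 * (n : ℝ)) *
        |1 - Real.exp ((n : ℝ) + 1) * ((m - 1)! : ℕ) *
              (poissonMeasure ((n : ℝ≥0) + 1)).real (Set.Iic (m - 1)) /
              ((n : ℝ) + 1) ^ (m - 1)|
        ≤ ProbParking.tvDist (ProbParking.lastCarLaw m n hm p) (ProbParking.uniformLaw n) ∧
    ((p : ℝ) = 1 / 2 →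
      1 / 2 * |(n : ℝ) ^ ((m : ℤ) - 2) / (2 * ((n : ℝ) + 1) ^ (m - 1)) -
          1 / (2 * ((n : ℝ) + 1)) *
            (1 + ((n : ℝ) - 2 * m + 2) / ((n : ℝ) * ((n : ℝ) - m + 1)))|
        ≤ ProbParking.tvDist (ProbParking.lastCarLaw m n hm p) (ProbParking.uniformLaw n)) := by
  open ProbParking in
  obtain ⟨M, rfl⟩ : ∃ M, m = M + 1 := ⟨m - 1, by omega⟩
  have h : M < n := hmn
  have hn : (0 : ℝ) < n := by exact_mod_cast (by omega : 0 < n)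
  have hMn : (0 : ℝ) < (n : ℝ) - M := by
    have : (M : ℝ) < n := by exact_mod_cast h
    linarith
  have hb := lineCount_succ_pos h
  have hF : ∀ j, 0 ≤ (p : ℝ) * tailWeight p n M j + (1 - p) * headWeight p n M j := fun j =>
    add_nonneg (mul_nonneg p.2.1 (tailWeight_nonneg p.2.1 p.2.2 n M j))
      (mul_nonneg (sub_nonneg.2 p.2.2) (headWeight_nonneg p.2.1 p.2.2 n M j))
  have hcast : (n : ℝ) - (M + 1 : ℕ) + 1 = n - M := by push_cast; ring
  have hla := lineCount_mul n M
  rw [tvDist_lastCarLaw h, hcast, Nat.add_sub_cancel]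
  refine ⟨(sum_abs_le (by omega) hF hb (sum_fault_eq p h)).trans_eq ?_, ?_, fun hp => ?_⟩
  · rw [div_eq_div_iff hb.ne' (by positivity), lineCount_succ]
    push_cast
    linear_combination (n : ℝ) * ((n : ℝ) - M) * hla
  · have key := le_sum_abs (n := n) (a := lineCount n M)
      (b := lineCount n (M + 1))
      (F := fun j => (p : ℝ) * tailWeight p n M j + (1 - p) * headWeight p n M j)
    rw [sum_centered_fault _ h, lineCount_succ, ← lineCount_succ n M] at key
    rw [exp_mul_factorial_mul_poisson]
    set G := ∑ k ∈ Finset.range (M + 1), (M ! : ℝ) / (k ! : ℝ) * ((n : ℝ) + 1) ^ k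
    have e : (2 * (p : ℝ) - 1) * (((n : ℝ) - M) * (G - ((n : ℝ) + 1) ^ M)) / lineCount n (M + 1)
        = (2 * p - 1) * -(1 - G / ((n : ℝ) + 1) ^ M) := by
      rw [lineCount_succ]
      field_simp
      ring
    rw [e, abs_mul, abs_neg] at key
    set T := ∑ j ∈ Finset.range n, |(lineCount n M
      - ((p : ℝ) * tailWeight p n M j + (1 - p) * headWeight p n M j)) / lineCount n (M + 1)
      - 1 / n|
    have hT : 0 ≤ T := Finset.sum_nonneg fun j _ => abs_nonneg _
    -- `key` is twice as strong as needed: it would allow `2 * n` in place of `4 * n`.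
    rw [div_mul_eq_mul_div, div_le_iff₀ (by positivity)]
    nlinarith [mul_nonneg hn.le hT]
  -- Only spot `0` is kept; its tail weight vanishes because `M < n` cars cannot fill the street.
  · have h0 := Finset.single_le_sum (f := fun j => |(lineCount n M
      - ((p : ℝ) * tailWeight p n M j + (1 - p) * headWeight p n M j)) / lineCount n (M + 1)
      - 1 / n|) (fun j _ => abs_nonneg _) (Finset.mem_range.2 (by omega : 0 < n))
    refine (le_of_eq ?_).trans (mul_le_mul_of_nonneg_left h0 (by norm_num))
    -- The exponent is an integer because it equals `-1` when `M = 0`.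
    have hz : (n : ℝ) ^ (((M + 1 : ℕ) : ℤ) - 2) = (n : ℝ) ^ M / n := by
      rw [← zpow_natCast, div_eq_mul_inv, ← zpow_sub_one₀ hn.ne']
      congr 1
      push_cast
      ring
    have hl : lineCount (n - 1) M * n = ((n : ℝ) - M) * (n : ℝ) ^ M := by
      have := lineCount_mul (n - 1) M
      rwa [show (((n - 1 : ℕ) : ℝ) + 1) = n by
        rw [Nat.cast_sub (by omega)]; push_cast; ring] at this
    have ha : lineCount n M = ((n : ℝ) + 1 - M) * ((n : ℝ) + 1) ^ M / (n + 1) :=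
      (eq_div_iff (by positivity)).2 hla
    have hl' : lineCount (n - 1) M = ((n : ℝ) - M) * (n : ℝ) ^ M / n :=
      (eq_div_iff hn.ne').2 hl
    rw [tailWeight_zero _ h, headWeight_zero _ h, hp, hz, hl', ha, lineCount_succ]
    congr 2
    push_cast
    field_simp
    ring
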